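/- **Theorem (Prevalence via a submersion probe).** Let $X\subseteq\mathbb R^d$ be closed and convex with non-empty interior and $C^2$ boundary $\partial X$, and for $x\in\partial X$ let $n(x)$ be the outward unit normal, i.e. the unique unit vector $v$ with $\langle v,y-x\rangle\le 0$ for all $y\in X$. For $x\in X$ let $\operatorname{TC}_X(x)=\overline{\{\lambda(y-x): y\in X,\ \lambda\ge 0\}}$ be the tangent cone, and for $Q:X\to\mathbb R^d$ let $Q^{\Pi}(x)$ be the metric projection of $Q(x)$ onto $\operatorname{TC}_X(x)$. Let $\mathcal Q$ be a complete metric vector space (a real vector space with a complete metric for which addition and scalar multiplication are continuous) whose elements are $C^1$ functions $X\to\mathbb R^d$; the vector space operations may be, but need not be, the pointwise ones. A set $S\subseteq\mathcal Q$ is *prevalent* if there is a finite-dimensional subspace $P'\subseteq\mathcal Q$ such that for every $Q\in\mathcal Q$ the set $\{p\in P': Q+p\in S\}$ has full Lebesgue measure in $P'$. Let $P\subseteq\mathcal Q$ be a finite-dimensional subspace such that for every $Q\in\mathcal Q$ both maps $$e^{Q}:P\times X\to\mathbb R^d,\quad e^{Q}(p,x)=(Q+p)(x),$$ $$e^{\tilde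 Q}:P\times\partial X\times[0,\infty)\to\mathbb R^d,\quad e^{\tilde Q}(p,x,\alpha)=(Q+p)(x)-\alpha\,n(x)$$ are $C^1$ submersions, i.e. are $C^1$ and have surjective differential at every point, on the tangent spaces $P\times\mathbb R^d$ and $P\times n(x)^{\perp}\times\mathbb R$ respectively (also at boundary points of the domains). Then the set of $Q\in\mathcal Q$ for which $\{x\in X: Q(x)=0\}$ is a discrete subset of $X$ and $\{x\in\partial X: Q^{\Pi}(x)=0\}$ is a discrete subset of $\partial X$ is prevalent in $\mathcal Q$. -/

import Mathlib

open Set Filter Topology MeasureTheory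

namespace SubmersionProbe

/-! ### The domain: tangent and normal cones, projection, `C²` boundary -/

/-- The tangent cone of a convex set `X` at `x`: the closure of `{t (y - x) | y ∈ X, t ≥ 0}`. -/
def tangentCone {d : ℕ} (X : Set (EuclideanSpace ℝ (Fin d))) (x : EuclideanSpace ℝ (Fin d)) :
    Set (EuclideanSpace ℝ (Fin d)) :=
  closure {v | ∃ y ∈ X, ∃ t : ℝ, 0 ≤ t ∧ v = t • (y - x)}

/-- The normal cone of a convex set `X` at `x`. -/
def normalCone {d : ℕ} (X : Set (EuclideanSpace ℝ (Fin d))) (x : EuclideanSpace ℝ (Fin d)) :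
    Set (EuclideanSpace ℝ (Fin d)) :=
  {v | ∀ y ∈ X, inner ℝ v (y - x) ≤ 0}

/-- The metric projection of `u` onto `K`: the point of `K` nearest to `u`
(it exists and is unique when `K` is nonempty, closed and convex). -/
noncomputable def metricProj {d : ℕ} (K : Set (EuclideanSpace ℝ (Fin d)))
    (u : EuclideanSpace ℝ (Fin d)) : EuclideanSpace ℝ (Fin d) :=
  Classical.epsilon fun v => v ∈ K ∧ ∀ w ∈ K, ‖u - v‖ ≤ ‖u - w‖

/-- `X` has `C²` boundary: near each boundary point, `X` is the sublevel set `{ρ ≤ 0}` of a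
`C²` function `ρ` with nonvanishing derivative at that point. -/
def HasC2Boundary {d : ℕ} (X : Set (EuclideanSpace ℝ (Fin d))) : Prop :=
  ∀ x ∈ frontier X, ∃ ρ : EuclideanSpace ℝ (Fin d) → ℝ,
    ContDiffAt ℝ 2 ρ x ∧ fderiv ℝ ρ x ≠ 0 ∧ ∀ᶠ y in 𝓝 x, (y ∈ X ↔ ρ y ≤ 0)

/-- The outward unit normal `n(x)` of a convex set `X` at a boundary point `x`: the unit vector of
the normal cone (it exists at every boundary point of a convex set with nonempty interior, and is
unique when the boundary is `C²`). -/
noncomputable def outwardNormal {d : ℕ} (X : Set (EuclideanSpace ℝ (Fin d)))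
    (x : EuclideanSpace ℝ (Fin d)) : EuclideanSpace ℝ (Fin d) :=
  Classical.epsilon fun v => v ∈ normalCone X x ∧ ‖v‖ = 1

/-- The boundary `∂X` of a closed set `X`, as a set of points of `X`. -/
def bdry {d : ℕ} (X : Set (EuclideanSpace ℝ (Fin d))) : Set X :=
  {x | (x : EuclideanSpace ℝ (Fin d)) ∈ frontier X}

/-! ### Vector fields on the domain -/

/-- A field on `X`, extended by zero to the whole space. Only its values on `X` are ever used. -/
noncomputable def extendZero {d : ℕ} {X : Set (EuclideanSpace ℝ (Fin d))}
    (f : X → EuclideanSpace ℝ (Fin d)) : EuclideanSpace ℝ (Fin d) → EuclideanSpace ℝ (Fin d) :=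
  Function.extend Subtype.val f 0

/-- The tangent-cone projected field `x ↦ Π_{TC_X(x)} f(x)` on `X`. -/
noncomputable def projectedField {d : ℕ} {X : Set (EuclideanSpace ℝ (Fin d))}
    (f : X → EuclideanSpace ℝ (Fin d)) : X → EuclideanSpace ℝ (Fin d) :=
  fun x => metricProj (tangentCone X x) (f x)

/-- The roots of a map on its domain. -/
def roots {α : Type*} {d : ℕ} (f : α → EuclideanSpace ℝ (Fin d)) : Set α :=
  {a | f a = 0}

/-! ### `C¹` submersions -/

/-- `F` is a `C¹` submersion on `S ⊆ V`, where `T z ⊆ V` is the tangent space of `S` at `z ∈ S`: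
`F` is `C¹` on `S`, and at each `z ∈ S` the differential maps `T z` onto the target. (The
derivative of `F` within `S` at `z` is unique on the tangent space.) -/
def IsC1Submersion {V W : Type*} [NormedAddCommGroup V] [NormedSpace ℝ V]
    [NormedAddCommGroup W] [NormedSpace ℝ W] (F : V → W) (S : Set V) (T : V → Set V) : Prop :=
  ContDiffOn ℝ 1 F S ∧
    ∀ z ∈ S, ∃ L : V →L[ℝ] W, HasFDerivWithinAt F L S z ∧ SurjOn L (T z) univ

/-! ### Finite-dimensional subspaces and prevalence -/

/-- Linear coordinates on a finite-dimensional subspace `P`. Another choice of coordinates differs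
by a linear automorphism of `ℝᵐ`, so that Lebesgue null sets and `C¹` submersions on `P` do not
depend on it. -/
noncomputable def coords {𝒬 : Type*} [AddCommGroup 𝒬] [Module ℝ 𝒬] (P : Submodule ℝ 𝒬)
    [FiniteDimensional ℝ P] : (Fin (Module.finrank ℝ P) → ℝ) ≃ₗ[ℝ] P :=
  (Module.finBasis ℝ P).equivFun.symm

/-- `S` is prevalent: for some finite-dimensional subspace `P` and every `Q`, the set
`{p ∈ P | Q + p ∈ S}` has full Lebesgue measure in `P`. -/
def IsPrevalent {𝒬 : Type*} [AddCommGroup 𝒬] [Module ℝ 𝒬] (S : Set 𝒬) : Prop :=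
  ∃ (P : Submodule ℝ 𝒬) (_ : FiniteDimensional ℝ P), ∀ Q : 𝒬,
    ∀ᵐ c ∂(volume : Measure (Fin (Module.finrank ℝ P) → ℝ)), Q + (coords P c : 𝒬) ∈ S

/-! ### The perturbed evaluation maps -/

section Evaluation

variable {d : ℕ} {X : Set (EuclideanSpace ℝ (Fin d))} {𝒬 : Type*} [AddCommGroup 𝒬] [Module ℝ 𝒬]
  [FunLike 𝒬 X (EuclideanSpace ℝ (Fin d))]

/-- The map `(p, x) ↦ (Q + p)(x)` on `P × X`, with `p` in linear coordinates. -/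
noncomputable def evalMap (P : Submodule ℝ 𝒬) [FiniteDimensional ℝ P] (Q : 𝒬) :
    (Fin (Module.finrank ℝ P) → ℝ) × EuclideanSpace ℝ (Fin d) → EuclideanSpace ℝ (Fin d) :=
  fun z => extendZero (⇑(Q + (coords P z.1 : 𝒬))) z.2

/-- The map `(p, x, α) ↦ (Q + p)(x) - α n(x)` on `P × ∂X × [0, ∞)`, with `p` in linear
coordinates. -/
noncomputable def evalMapBdry (P : Submodule ℝ 𝒬) [FiniteDimensional ℝ P] (Q : 𝒬) :
    (Fin (Module.finrank ℝ P) → ℝ) × EuclideanSpace ℝ (Fin d) × ℝ → EuclideanSpace ℝ (Fin d) :=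
  fun z => extendZero (⇑(Q + (coords P z.1 : 𝒬))) z.2.1 - z.2.2 • outwardNormal X z.2.1

/-- `(p, x) ↦ (Q + p)(x)` is a `C¹` submersion on `P × X`; as `X` has full dimension, the tangent
spaces are the whole space, also at boundary points. -/
def EvalIsC1Submersion (P : Submodule ℝ 𝒬) [FiniteDimensional ℝ P] (Q : 𝒬) : Prop :=
  IsC1Submersion (evalMap P Q) (univ ×ˢ X) fun _ => univ

/-- `(p, x, α) ↦ (Q + p)(x) - α n(x)` is a `C¹` submersion on `P × ∂X × [0, ∞)`; the tangent space
of `∂X` at `x` is the orthogonal complement of `n(x)`. -/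
def EvalBdryIsC1Submersion (P : Submodule ℝ 𝒬) [FiniteDimensional ℝ P] (Q : 𝒬) : Prop :=
  IsC1Submersion (evalMapBdry P Q) (univ ×ˢ frontier X ×ˢ Ici 0) fun z =>
    univ ×ˢ {v | inner ℝ v (outwardNormal X z.2.1) = 0} ×ˢ univ

end Evaluation

end SubmersionProbe

/-! The probe is `P` itself, so for each `Q` it suffices that almost every `p ∈ P` makes both root
sets discrete. This is parametric transversality in equal dimensions. If `F(c, x)` is a submersion
and `x` ranges over a space of the dimension of the target, the zero set of `F` has the dimension of
the parameter space. Its projection to the parameters is critical at a zero exactly when `∂F/∂x` has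
a kernel there. The equal-dimensional Sard theorem, valid for `C¹` maps, makes the critical values
null (`exists_nhds_critical_image_null`). For every other `c`, `∂F/∂x` is injective at each zero, so
zeros are isolated (`ae_zeros_isolated`).

For roots of `Q + p`, this applies directly on `X`. On the boundary, a zero projection onto the
tangent cone puts the value in the normal cone, which is the ray of `n(x)` because the boundary is
regular. Thus `(Q + p)(x) = α n(x)` with `α = ‖(Q + p)(x)‖`. In a chart from `exists_boundary_chart`
the unknown `(u, α)` has `(d - 1) + 1 = d` coordinates, and the same theorem applies. Both domains
have boundary, so derivatives are taken within convex sets and no extension of `F` is needed. -/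

namespace SubmersionProbe

/-! ### Parametric transversality on convex domains -/

section Parametric

theorem continuous_prod_right {V W C : Type*} [NormedAddCommGroup V] [NormedSpace ℝ V]
    [NormedAddCommGroup W] [NormedSpace ℝ W] [NormedAddCommGroup C] [NormedSpace ℝ C]
    (A : V →L[ℝ] C) :
    Continuous fun L : V →L[ℝ] W => L.prod A := by
  have h : (fun L : V →L[ℝ] W => L.prod A) = fun L =>
      (ContinuousLinearMap.inl ℝ W C).comp L + (ContinuousLinearMap.inr ℝ W C).comp A := by
    ext L v <;> simp
  rw [h]
  exact (continuous_const.clm_comp continuous_id).add continuous_const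

variable {V W C E : Type*}
  [NormedAddCommGroup V] [NormedSpace ℝ V] [FiniteDimensional ℝ V]
  [NormedAddCommGroup W] [NormedSpace ℝ W] [FiniteDimensional ℝ W]
  [NormedAddCommGroup C] [NormedSpace ℝ C] [FiniteDimensional ℝ C]
  [NormedAddCommGroup E] [NormedSpace ℝ E] [FiniteDimensional ℝ E]

/-- A surjective linear map can be completed to an isomorphism by a map to any space of the
dimension of its kernel. -/
theorem exists_equiv_eq_prod (L : V →L[ℝ] W) (hL : Function.Surjective L)
    (hdim : Module.finrank ℝ V = Module.finrank ℝ W + Module.finrank ℝ C) :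
    ∃ (A : V →L[ℝ] C) (e : V ≃L[ℝ] W × C), (e : V →L[ℝ] W × C) = L.prod A := by
  have hk : Module.finrank ℝ L.ker = Module.finrank ℝ C := by
    have h1 := L.toLinearMap.finrank_range_add_finrank_ker
    have h2 : L.toLinearMap.range = ⊤ := LinearMap.range_eq_top.2 hL
    rw [h2, finrank_top] at h1
    have : Module.finrank ℝ L.ker = Module.finrank ℝ L.toLinearMap.ker := rfl
    omega
  obtain ⟨r, hr⟩ := L.ker_closedComplemented_of_finiteDimensional_range
  let i : L.ker ≃L[ℝ] C := ContinuousLinearEquiv.ofFinrankEq hk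
  let A : V →L[ℝ] C := (i : L.ker →L[ℝ] C).comp r
  have hinj : Function.Injective (L.prod A) := by
    rw [injective_iff_map_eq_zero]
    intro v hv
    have h1 : L v = 0 := congrArg Prod.fst hv
    have h2 : i (r v) = 0 := congrArg Prod.snd hv
    have h3 : r v = 0 := by simpa using h2
    have h4 := hr ⟨v, h1⟩
    rw [h3] at h4
    exact (congrArg Subtype.val h4).symm
  have hd : Module.finrank ℝ V = Module.finrank ℝ (W × C) := by
    rw [Module.finrank_prod, hdim]
  refine ⟨A, (LinearMap.linearEquivOfInjective (L.prod A).toLinearMap hinj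
    hd).toContinuousLinearEquiv, ?_⟩
  ext v <;> simp

/-- Local form of the measure-zero theorem for the critical values of a linear map restricted to
the zero set of a `C¹` submersion. -/
theorem exists_nhds_critical_image_null [MeasurableSpace C] [BorelSpace C]
    (μ : Measure C) [μ.IsAddHaarMeasure]
    (hdim : Module.finrank ℝ V = Module.finrank ℝ W + Module.finrank ℝ C)
    {S : Set V} (hS : Convex ℝ S) {F : V → W} {F' : V → V →L[ℝ] W}
    (hF : ∀ z ∈ S, HasFDerivWithinAt F (F' z) S z) (hF' : ContinuousOn F' S)
    (π : V →L[ℝ] C) {z₀ : V} (hz₀ : z₀ ∈ S) (hsurj : Function.Surjective (F' z₀)) :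
    ∃ U ∈ 𝓝[S] z₀, μ (π '' {z ∈ U | F z = 0 ∧ ∃ v ≠ 0, F' z v = 0 ∧ π v = 0}) = 0 := by
  obtain ⟨A, e, he⟩ := exists_equiv_eq_prod (C := C) (F' z₀) hsurj hdim
  let Ψ : V → W × C := fun z => (F z, A z)
  let Ψ' : V → V →L[ℝ] W × C := fun z => (F' z).prod A
  have hΨ : ∀ z ∈ S, HasFDerivWithinAt Ψ (Ψ' z) S z := fun z hz =>
    (hF z hz).prodMk A.hasFDerivWithinAt
  have hΨ'c : ContinuousOn Ψ' S :=
    (continuous_prod_right A).comp_continuousOn hF'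
  have hΨ₀ : Ψ' z₀ = e := he.symm
  -- On a trivial space the inverse has norm zero, so no positive constant lies below the reciprocal
  -- of that norm.
  obtain ⟨c, hc0, hc⟩ : ∃ c : NNReal, 0 < c ∧
      (Subsingleton V ∨ c < ‖(e.symm : (W × C) →L[ℝ] V)‖₊⁻¹) := by
    rcases subsingleton_or_nontrivial V with h | h
    · exact ⟨1, one_pos, Or.inl h⟩
    · obtain ⟨c, h0, h1⟩ := exists_between (inv_pos.2 e.nnnorm_symm_pos)
      exact ⟨c, h0, Or.inr h1⟩
  have hnear : ∀ᶠ z in 𝓝[S] z₀, ‖Ψ' z - e‖ ≤ c ∧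
      Ψ' z ∈ range ((↑) : (V ≃L[ℝ] W × C) → V →L[ℝ] W × C) := by
    have ht : Tendsto Ψ' (𝓝[S] z₀) (𝓝 (e : V →L[ℝ] W × C)) := by
      rw [← hΨ₀]; exact hΨ'c z₀ hz₀
    have hc' : ∀ᶠ L in 𝓝 (e : V →L[ℝ] W × C), ‖L - (e : V →L[ℝ] W × C)‖ ≤ c := by
      filter_upwards [Metric.closedBall_mem_nhds (e : V →L[ℝ] W × C) (NNReal.coe_pos.2 hc0)]
        with L hL
      simpa [dist_eq_norm] using hL
    exact (ht.eventually hc').and (ht.eventually_mem (ContinuousLinearEquiv.nhds e))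
  obtain ⟨ε, hε, hball⟩ := Metric.mem_nhdsWithin_iff.1 hnear
  set U : Set V := Metric.ball z₀ ε ∩ S
  have hUS : U ⊆ S := inter_subset_right
  -- The mean value inequality on the convex set `ball ∩ S` stands in for the inverse function
  -- theorem, which does not cover boundary points of `S`.
  have happ : ApproximatesLinearOn Ψ (e : V →L[ℝ] W × C) U c := by
    intro y hy x hx
    exact ((convex_ball z₀ ε).inter hS).norm_image_sub_le_of_norm_hasFDerivWithin_le'
      (fun z hz => (hΨ z (hUS hz)).mono hUS) (fun z hz => (hball hz).1) hx hy
  let g : W × C → V := Function.invFunOn Ψ U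
  have hinj : InjOn Ψ U := happ.injOn hc
  have hgl : ∀ z ∈ U, g (Ψ z) = z := fun z hz => hinj.leftInvOn_invFunOn hz
  have hganti := happ.antilipschitz hc
  have hg : ∀ z ∈ U, ∀ ez : V ≃L[ℝ] W × C, (ez : V →L[ℝ] W × C) = Ψ' z →
      HasFDerivWithinAt g (ez.symm : W × C →L[ℝ] V) (Ψ '' U) (Ψ z) := by
    intro z hz ez hez
    refine HasFDerivWithinAt.of_local_left_inverse (t := U) (f := Ψ) ?_ ?_ (mem_image_of_mem _ hz) ?_
    · rw [hgl z hz]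
      have hmaps : MapsTo g (Ψ '' U) U := by
        rintro _ ⟨y, hy, rfl⟩; rw [hgl y hy]; exact hy
      refine tendsto_nhdsWithin_iff.2 ⟨?_, eventually_mem_nhdsWithin.mono hmaps⟩
      have hlip : LipschitzOnWith (‖(e.symm : (W × C) →L[ℝ] V)‖₊⁻¹ - c)⁻¹ g (Ψ '' U) := by
        rintro _ ⟨x, hx, rfl⟩ _ ⟨y, hy, rfl⟩
        rw [hgl x hx, hgl y hy]
        exact hganti ⟨x, hx⟩ ⟨y, hy⟩
      have := hlip.continuousOn (Ψ z) (mem_image_of_mem _ hz)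
      rwa [ContinuousWithinAt, hgl z hz] at this
    · rw [hgl z hz, hez]
      exact (hΨ z (hUS hz)).mono hUS
    · refine eventually_mem_nhdsWithin.mono ?_
      rintro _ ⟨y, hy, rfl⟩
      rw [hgl y hy]
  refine ⟨U, inter_mem (mem_nhdsWithin_of_mem_nhds (Metric.ball_mem_nhds z₀ hε))
    self_mem_nhdsWithin, ?_⟩
  set B := {z ∈ U | F z = 0 ∧ ∃ v ≠ 0, F' z v = 0 ∧ π v = 0}
  let ez : V → (W × C →L[ℝ] V) := fun z => (Ψ' z).inverse
  -- On zeros of `F`, `Ψ` is `(0, A z)`. So `A` gives coordinates on the zero set, in which `π`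
  -- becomes a map between spaces of equal dimension.
  let f : C → C := fun k => π (g (0, k))
  let f' : C → C →L[ℝ] C := fun k =>
    π.comp ((ez (g (0, k))).comp (ContinuousLinearMap.inr ℝ W C))
  have hBΨ : ∀ z ∈ B, Ψ z = (0, A z) := fun z hz => by simp [Ψ, hz.2.1]
  have himage : π '' B = f '' (A '' B) := by
    rw [image_image]
    refine image_congr fun z hz => ?_
    simp only [f]
    rw [← hBΨ z hz, hgl z hz.1]
  rw [himage]
  refine addHaar_image_eq_zero_of_det_fderivWithin_eq_zero μ (f' := f') ?_ ?_
  · rintro _ ⟨z, hz, rfl⟩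
    obtain ⟨e₁, he₁⟩ := (hball hz.1).2
    have h1 : g (0, A z) = z := by rw [← hBΨ z hz, hgl z hz.1]
    have h2 : f' (A z) = π.comp ((e₁.symm : W × C →L[ℝ] V).comp
        (ContinuousLinearMap.inr ℝ W C)) := by
      simp only [f', h1, ez, ← he₁, ContinuousLinearMap.inverse_equiv]
    rw [h2]
    refine π.hasFDerivAt.comp_hasFDerivWithinAt (A z) ?_
    have h3 := hg z hz.1 e₁ he₁
    rw [hBΨ z hz] at h3
    refine HasFDerivWithinAt.comp (A z) (g := g) (f := fun k : C => ((0 : W), k)) h3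
      (ContinuousLinearMap.inr ℝ W C).hasFDerivWithinAt ?_
    rintro _ ⟨y, hy, rfl⟩
    exact ⟨y, hy.1, hBΨ y hy⟩
  · rintro _ ⟨z, hz, rfl⟩
    obtain ⟨e₁, he₁⟩ := (hball hz.1).2
    obtain ⟨v, hv0, hv1, hv2⟩ := hz.2.2
    have h1 : g (0, A z) = z := by rw [← hBΨ z hz, hgl z hz.1]
    -- The vector `v` is tangent to the zero set and killed by `π`; its coordinate vector `A v` is
    -- nonzero and lies in the kernel of `f'`, so the determinant vanishes.
    have h4 : e₁ v = (0, A v) := by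
      have : (e₁ : V →L[ℝ] W × C) v = Ψ' z v := by rw [he₁]
      simpa [Ψ', hv1] using this
    have hAv : A v ≠ 0 := fun h => hv0 (e₁.map_eq_zero_iff.1 (by rw [h4, h]; rfl))
    have h5 : f' (A z) (A v) = 0 := by
      simp only [f', h1, ez, ← he₁, ContinuousLinearMap.inverse_equiv,
        ContinuousLinearMap.comp_apply, ContinuousLinearMap.inr_apply]
      rw [← h4]
      simpa using hv2
    by_contra hdet
    refine hAv ?_
    have hker : LinearMap.ker (f' (A z)).toLinearMap = ⊥ := by
      by_contra hne
      exact hdet (LinearMap.det_eq_zero_iff_ker_ne_bot.2 hne)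
    exact LinearMap.ker_eq_bot'.1 hker _ h5

/-- Parametric transversality between spaces of equal dimension: if `F` is a `C¹` submersion on
`C × D`, then for almost every `c` the zeros of `F (c, ·)` on `D` are isolated. -/
theorem ae_zeros_isolated [MeasurableSpace C] [BorelSpace C]
    (μ : Measure C) [μ.IsAddHaarMeasure]
    (hdim : Module.finrank ℝ E = Module.finrank ℝ W)
    {D : Set E} (hD : Convex ℝ D) (hDint : (interior D).Nonempty) {F : C × E → W}
    (hF : ContDiffOn ℝ 1 F (univ ×ˢ D))
    (hsurj : ∀ z ∈ (univ : Set C) ×ˢ D, ∃ L : C × E →L[ℝ] W,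
      HasFDerivWithinAt F L (univ ×ˢ D) z ∧ Function.Surjective L) :
    ∀ᵐ c ∂μ, ∀ x ∈ D, F (c, x) = 0 → ∀ᶠ y in 𝓝[D \ {x}] x, F (c, y) ≠ 0 := by
  set S : Set (C × E) := univ ×ˢ D with hSdef
  have hS : Convex ℝ S := convex_univ.prod hD
  have hSint : (interior S).Nonempty := by
    rw [hSdef, interior_prod_eq, interior_univ]
    exact univ_nonempty.prod hDint
  have hud : UniqueDiffOn ℝ S := uniqueDiffOn_convex hS hSint
  let F' := fderivWithin ℝ F S
  have hder : ∀ z ∈ S, HasFDerivWithinAt F (F' z) S z := fun z hz =>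
    (hF.differentiableOn (by norm_num) z hz).hasFDerivWithinAt
  have hcont : ContinuousOn F' S := hF.continuousOn_fderivWithin hud (by norm_num)
  have hsurj' : ∀ z ∈ S, Function.Surjective (F' z) := by
    intro z hz
    obtain ⟨L, hL, hLs⟩ := hsurj z hz
    rwa [(hud z hz).eq (hder z hz) hL]
  have hdim' : Module.finrank ℝ (C × E) = Module.finrank ℝ W + Module.finrank ℝ C := by
    rw [Module.finrank_prod, hdim, add_comm]
  let bad : Set (C × E) → Set (C × E) := fun U =>
    {z ∈ U | F z = 0 ∧ ∃ v ≠ 0, F' z v = 0 ∧ ContinuousLinearMap.fst ℝ C E v = 0}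
  have hloc : ∀ z ∈ S, ∃ U ∈ 𝓝[S] z, μ (ContinuousLinearMap.fst ℝ C E '' bad U) = 0 :=
    fun z hz => exists_nhds_critical_image_null μ hdim' hS hder hcont _ hz (hsurj' z hz)
  choose! U hU hUnull using hloc
  -- Lindelöf: countably many of the local null sets suffice.
  obtain ⟨t, htS, htc, hcover⟩ := TopologicalSpace.countable_cover_nhdsWithin hU
  have hnull : ∀ᵐ c ∂μ, ∀ z ∈ t, c ∉ ContinuousLinearMap.fst ℝ C E '' bad (U z) :=
    (ae_ball_iff htc).2 fun z hz => measure_eq_zero_iff_ae_notMem.1 (hUnull z (htS hz))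
  filter_upwards [hnull] with c hc x hx hzero
  have hz : (c, x) ∈ S := ⟨mem_univ _, hx⟩
  obtain ⟨z, hzt, hzU⟩ := mem_iUnion₂.1 (hcover hz)
  have hx' : HasFDerivWithinAt (fun y => F (c, y))
      ((F' (c, x)).comp (ContinuousLinearMap.inr ℝ C E)) D x :=
    HasFDerivWithinAt.comp (g := F) (f := fun y => (c, y)) x (hder _ hz)
      (hasFDerivAt_prodMk_right c x).hasFDerivWithinAt fun y hy => ⟨mem_univ _, hy⟩
  refine hx'.eventually_ne ?_
  -- A kernel vector `v` of the partial derivative would give `(0, v)`, killed by both `F'` and the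
  -- projection, so `c` would be a critical value.
  have hinj : LinearMap.ker ((F' (c, x)).comp (ContinuousLinearMap.inr ℝ C E)).toLinearMap = ⊥ := by
    refine LinearMap.ker_eq_bot'.2 fun v hv => ?_
    by_contra hne
    exact hc z hzt ⟨(c, x), ⟨hzU, hzero, (0, v), by simpa using hne, by simpa using hv, rfl⟩, rfl⟩
  obtain ⟨K, -, hK⟩ := LinearMap.exists_antilipschitzWith _ hinj
  exact ⟨K, hK⟩

end Parametric

end SubmersionProbe

/-! ### Normal cones and charts of the boundary -/

namespace SubmersionProbe

section Boundary

variable {d : ℕ} {X : Set (EuclideanSpace ℝ (Fin d))}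

/-- Hahn–Banach separates `x` from the interior; the separating functional, represented as a vector
and normalized, is a unit normal because `X` lies in the closure of its interior. -/
theorem outwardNormal_spec (hXconvex : Convex ℝ X)
    (hXint : (interior X).Nonempty) {x : EuclideanSpace ℝ (Fin d)} (hx : x ∈ frontier X) :
    outwardNormal X x ∈ normalCone X x ∧ ‖outwardNormal X x‖ = 1 := by
  refine Classical.epsilon_spec (p := fun v => v ∈ normalCone X x ∧ ‖v‖ = 1) ?_
  have hxi : x ∉ interior X := hx.2
  obtain ⟨f, hf⟩ := geometric_hahn_banach_open_point hXconvex.interior isOpen_interior hxi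
  let v := (InnerProductSpace.toDual ℝ (EuclideanSpace ℝ (Fin d))).symm f
  have hv : ∀ w, inner ℝ v w = f w := fun w => InnerProductSpace.toDual_symm_apply
  have hle : ∀ y ∈ X, f y ≤ f x := by
    intro y hy
    have hsub : closure (interior X) ⊆ {y | f y ≤ f x} :=
      closure_minimal (fun y hy => (hf y hy).le) (isClosed_le f.continuous continuous_const)
    refine hsub ?_
    rw [hXconvex.closure_interior_eq_closure_of_nonempty_interior hXint]
    exact subset_closure hy
  obtain ⟨y₀, hy₀⟩ := hXint
  have hv0 : v ≠ 0 := by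
    intro h
    have h1 := hf y₀ hy₀
    rw [← hv, ← hv, h] at h1
    simp at h1
  refine ⟨‖v‖⁻¹ • v, fun y hy => ?_, norm_smul_inv_norm hv0⟩
  rw [real_inner_smul_left, hv, map_sub]
  exact mul_nonpos_of_nonneg_of_nonpos (by positivity) (by linarith [hle y hy])

/-- If `u` had positive inner product with some `y - x`, its projection onto that ray would be a
point of the cone closer to `u` than the origin. -/
theorem mem_normalCone_of_metricProj_eq_zero {x u : EuclideanSpace ℝ (Fin d)} (hx : x ∈ X)
    (h : metricProj (tangentCone X x) u = 0) : u ∈ normalCone X x := by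
  have hne : (tangentCone X x).Nonempty := ⟨0, subset_closure ⟨x, hx, 0, le_rfl, by simp⟩⟩
  have hspec : metricProj (tangentCone X x) u ∈ tangentCone X x ∧
      ∀ w ∈ tangentCone X x, ‖u - metricProj (tangentCone X x) u‖ ≤ ‖u - w‖ := by
    refine Classical.epsilon_spec
      (p := fun v => v ∈ tangentCone X x ∧ ∀ w ∈ tangentCone X x, ‖u - v‖ ≤ ‖u - w‖) ?_
    obtain ⟨v, hv, hvd⟩ := isClosed_closure.exists_infDist_eq_dist hne u
    refine ⟨v, hv, fun w hw => ?_⟩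
    rw [← dist_eq_norm, ← dist_eq_norm, ← hvd]
    exact Metric.infDist_le_dist_of_mem hw
  rw [h, sub_zero] at hspec
  intro y hy
  by_contra! hpos
  set w := y - x with hw
  have hwn : 0 < ‖w‖ ^ 2 := by
    have : w ≠ 0 := by rintro h0; simp [h0] at hpos
    positivity
  have h1 := hspec.2 ((inner ℝ u w / ‖w‖ ^ 2) • w)
    (subset_closure ⟨y, hy, inner ℝ u w / ‖w‖ ^ 2, by positivity, rfl⟩)
  have h2 : ‖u‖ ^ 2 ≤ ‖u - (inner ℝ u w / ‖w‖ ^ 2) • w‖ ^ 2 := by gcongr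
  rw [norm_sub_sq_real, real_inner_smul_right, norm_smul, mul_pow, Real.norm_eq_abs, sq_abs] at h2
  have h3 : (inner ℝ u w / ‖w‖ ^ 2) ^ 2 * ‖w‖ ^ 2 = inner ℝ u w / ‖w‖ ^ 2 * inner ℝ u w := by
    field_simp
  have h4 : 0 < inner ℝ u w / ‖w‖ ^ 2 * inner ℝ u w := by positivity
  linarith

variable {ρ : EuclideanSpace ℝ (Fin d) → ℝ} {x : EuclideanSpace ℝ (Fin d)}

/-- At a regular boundary point of a sublevel set, normal vectors are nonnegative multiples of the
gradient of the defining function. -/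
theorem exists_inner_eq_mul_fderiv (hρ : DifferentiableAt ℝ ρ x) (hρ0 : fderiv ℝ ρ x ≠ 0)
    (hX : ∀ᶠ y in 𝓝 x, (y ∈ X ↔ ρ y ≤ 0)) (hx : ρ x = 0) {v : EuclideanSpace ℝ (Fin d)}
    (hv : v ∈ normalCone X x) :
    ∃ c : ℝ, 0 ≤ c ∧ ∀ w, inner ℝ v w = c * fderiv ℝ ρ x w := by
  -- Such directions `w` enter `X` at once. The rest is Farkas' lemma for a single functional.
  have hneg : ∀ w, fderiv ℝ ρ x w < 0 → inner ℝ v w ≤ 0 := by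
    intro w hw
    have hline : HasDerivAt (fun t : ℝ => x + t • w) w 0 := by
      simpa using ((hasDerivAt_id (0 : ℝ)).smul_const w).const_add x
    have hd : HasDerivAt (fun t : ℝ => ρ (x + t • w)) (fderiv ℝ ρ x w) 0 := by
      have h0 : HasFDerivAt ρ (fderiv ℝ ρ x) (x + (0 : ℝ) • w) := by simpa using hρ.hasFDerivAt
      exact h0.comp_hasDerivAt (0 : ℝ) hline
    have h1 : ∀ᶠ t in 𝓝[>] (0 : ℝ), slope (fun t : ℝ => ρ (x + t • w)) 0 t < 0 :=
      ((hasDerivAt_iff_tendsto_slope.1 hd).eventually (gt_mem_nhds hw)).filter_mono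
        (nhdsWithin_mono _ fun t (ht : 0 < t) => ht.ne')
    have h2 : ∀ᶠ t in 𝓝[>] (0 : ℝ), (x + t • w ∈ X ↔ ρ (x + t • w) ≤ 0) := by
      have h0 : Tendsto (fun t : ℝ => x + t • w) (𝓝 0) (𝓝 x) := by
        simpa using hline.continuousAt.tendsto
      exact (h0.eventually hX).filter_mono nhdsWithin_le_nhds
    obtain ⟨t, ht1, ht2, ht⟩ := (h1.and (h2.and self_mem_nhdsWithin)).exists
    have ht : 0 < t := ht
    have h3 : ρ (x + t • w) ≤ 0 := by
      rw [slope_def_field] at ht1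
      simp only [zero_smul, add_zero, hx, sub_zero] at ht1
      exact ((div_neg_iff.1 ht1).resolve_left fun h => h.2.not_gt ht).1.le
    have h4 := hv _ (ht2.2 h3)
    rw [add_sub_cancel_left, real_inner_smul_right] at h4
    exact nonpos_of_mul_nonpos_right h4 ht
  obtain ⟨w₁, hw₁⟩ : ∃ w, fderiv ℝ ρ x w ≠ 0 := by
    by_contra! h
    exact hρ0 (ContinuousLinearMap.ext h)
  set w₀ := -(fderiv ℝ ρ x w₁)⁻¹ • w₁ with hw₀def
  have hw₀ : fderiv ℝ ρ x w₀ = -1 := by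
    simp [hw₀def, hw₁]
  have hc : inner ℝ v w₀ ≤ 0 := hneg w₀ (by rw [hw₀]; norm_num)
  have hle : ∀ u, fderiv ℝ ρ x u = 0 → inner ℝ v u ≤ 0 := by
    intro u hu
    refine le_of_forall_pos_le_add fun ε hε => ?_
    -- Tilting `u` by `s • w₀` makes the derivative strictly negative at a cost of at most `ε`; the
    -- summand `1` keeps the denominator positive.
    set s := ε / (1 - inner ℝ v w₀) with hs
    have hspos : 0 < s := div_pos hε (by linarith)
    have h1 := hneg (u + s • w₀) (by simp [hu, hw₀, hspos])
    rw [inner_add_right, real_inner_smul_right] at h1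
    have h2 : s * (1 - inner ℝ v w₀) = ε := div_mul_cancel₀ _ (by linarith)
    nlinarith
  refine ⟨-inner ℝ v w₀, by linarith, fun w => ?_⟩
  have hu : fderiv ℝ ρ x (w + fderiv ℝ ρ x w • w₀) = 0 := by simp [hw₀]
  have h1 := hle _ hu
  have h2 := hle (-(w + fderiv ℝ ρ x w • w₀)) (by rw [map_neg, hu, neg_zero])
  rw [inner_neg_right] at h2
  rw [inner_add_right, real_inner_smul_right] at h1 h2
  linarith

theorem eq_zero_of_mem_frontier (hXclosed : IsClosed X) (hρ : ContinuousAt ρ x)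
    (hX : ∀ᶠ y in 𝓝 x, (y ∈ X ↔ ρ y ≤ 0)) (hx : x ∈ frontier X) : ρ x = 0 := by
  refine le_antisymm (hX.self_of_nhds.1 (hXclosed.frontier_subset hx)) (not_lt.1 fun h => hx.2 ?_)
  rw [mem_interior_iff_mem_nhds]
  filter_upwards [hX, hρ.eventually (gt_mem_nhds h)] with y hy hy'
  exact hy.2 hy'.le

/-- At an interior point `ρ` would have a local maximum, forcing its derivative to vanish. -/
theorem mem_frontier_of_eq_zero (hρ0 : fderiv ℝ ρ x ≠ 0)
    (hX : ∀ᶠ y in 𝓝 x, (y ∈ X ↔ ρ y ≤ 0)) (hx : ρ x = 0) : x ∈ frontier X := by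
  refine ⟨subset_closure (hX.self_of_nhds.2 hx.le), fun hi => hρ0 ?_⟩
  refine IsLocalMax.fderiv_eq_zero ?_
  filter_upwards [hX, mem_interior_iff_mem_nhds.1 hi] with y hy hyX
  rw [hx]
  exact hy.1 hyX

/-- At a regular boundary point, the normal cone is the ray of the outward unit normal. -/
theorem eq_norm_smul_outwardNormal (hXclosed : IsClosed X) (hXconvex : Convex ℝ X)
    (hXint : (interior X).Nonempty) (hXbdry : HasC2Boundary X) (hx : x ∈ frontier X)
    {v : EuclideanSpace ℝ (Fin d)} (hv : v ∈ normalCone X x) :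
    v = ‖v‖ • outwardNormal X x := by
  obtain ⟨ρ, hρ, hρ0, hX⟩ := hXbdry x hx
  have hρd := hρ.differentiableAt (by norm_num)
  have hρx := eq_zero_of_mem_frontier hXclosed hρ.continuousAt hX hx
  obtain ⟨hn, hn1⟩ := outwardNormal_spec hXconvex hXint hx
  obtain ⟨a, ha, hva⟩ := exists_inner_eq_mul_fderiv hρd hρ0 hX hρx hv
  obtain ⟨b, hb, hnb⟩ := exists_inner_eq_mul_fderiv hρd hρ0 hX hρx hn
  have hb0 : b ≠ 0 := by
    rintro rfl
    have h1 := hnb (outwardNormal X x)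
    rw [real_inner_self_eq_norm_sq, hn1] at h1
    norm_num at h1
  have hvn : v = (a / b) • outwardNormal X x := by
    refine ext_inner_right ℝ fun w => ?_
    rw [real_inner_smul_left, hva, hnb]
    field_simp
  have hnorm : ‖v‖ = a / b := by
    rw [hvn, norm_smul, hn1, mul_one, Real.norm_of_nonneg (by positivity)]
  rw [hnorm]
  exact hvn

/-- A `C¹` parametrization of `∂X` near a boundary point, with a left inverse defined on the whole
space. -/
theorem exists_boundary_chart (hXclosed : IsClosed X) (hXconvex : Convex ℝ X)
    (hXint : (interior X).Nonempty) (hXbdry : HasC2Boundary X) (hx : x ∈ frontier X) :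
    ∃ k, k + 1 = d ∧ ∃ (A : EuclideanSpace ℝ (Fin d) →L[ℝ] EuclideanSpace ℝ (Fin k))
      (φ : EuclideanSpace ℝ (Fin k) → EuclideanSpace ℝ (Fin d))
      (U : Set (EuclideanSpace ℝ (Fin k))) (N : Set (EuclideanSpace ℝ (Fin d))),
      IsOpen U ∧ Convex ℝ U ∧ U.Nonempty ∧ IsOpen N ∧ x ∈ N ∧ ContDiffOn ℝ 1 φ U ∧
      MapsTo φ U (frontier X) ∧
      (∀ u ∈ U, ∃ L : EuclideanSpace ℝ (Fin k) →L[ℝ] EuclideanSpace ℝ (Fin d),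
        HasFDerivAt φ L u ∧ ∀ w, inner ℝ w (outwardNormal X (φ u)) = 0 → ∃ v, L v = w) ∧
      ∀ y ∈ N ∩ frontier X, A y ∈ U ∧ φ (A y) = y := by
  obtain ⟨ρ, hρ, hρ0, hX⟩ := hXbdry x hx
  have hρ := hρ.of_le (m := 1) (by norm_num)
  have hρx := eq_zero_of_mem_frontier hXclosed hρ.continuousAt hX hx
  have hsurj : Function.Surjective (fderiv ℝ ρ x) := by
    refine LinearMap.surjective (f := (fderiv ℝ ρ x).toLinearMap) fun h => hρ0 ?_
    ext w
    exact LinearMap.congr_fun h w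
  have hd : 1 ≤ d := by
    have := LinearMap.finrank_le_finrank_of_surjective (f := (fderiv ℝ ρ x).toLinearMap) hsurj
    simpa using this
  obtain ⟨k, rfl⟩ : ∃ k, d = k + 1 := ⟨d - 1, by omega⟩
  obtain ⟨A, e, he⟩ := exists_equiv_eq_prod (C := EuclideanSpace ℝ (Fin k)) (fderiv ℝ ρ x) hsurj
    (by simp [add_comm])
  let Φ : EuclideanSpace ℝ (Fin (k + 1)) → ℝ × EuclideanSpace ℝ (Fin k) := fun y => (ρ y, A y)
  have hΦc : ∀ y, ContDiffAt ℝ 1 ρ y → ContDiffAt ℝ 1 Φ y := fun y hy =>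
    hy.prodMk A.contDiff.contDiffAt
  have hΦd : ∀ y, ContDiffAt ℝ 1 ρ y → HasFDerivAt Φ ((fderiv ℝ ρ y).prod A) y := fun y hy =>
    (hy.differentiableAt (by norm_num)).hasFDerivAt.prodMk A.hasFDerivAt
  have hΦx : HasFDerivAt Φ (e : _ →L[ℝ] _) x := he ▸ hΦd x hρ
  let h := (hΦc x hρ).toOpenPartialHomeomorph Φ hΦx (by norm_num)
  have hcoe : ∀ y, h y = Φ y := fun _ => rfl
  have hxs : x ∈ h.source := (hΦc x hρ).mem_toOpenPartialHomeomorph_source hΦx (by norm_num)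
  have hΦx0 : Φ x = (0, A x) := by simp [Φ, hρx]
  -- `HasC2Boundary` gives regularity of `ρ` at `x` only; continuity spreads it to nearby points.
  have hgood : ∀ᶠ y in 𝓝 x, y ∈ h.source ∧ ContDiffAt ℝ 1 ρ y ∧ fderiv ℝ ρ y ≠ 0 ∧
      (∀ᶠ z in 𝓝 y, (z ∈ X ↔ ρ z ≤ 0)) ∧
      (fderiv ℝ ρ y).prod A ∈ range ((↑) : (EuclideanSpace ℝ (Fin (k + 1)) ≃L[ℝ]
        ℝ × EuclideanSpace ℝ (Fin k)) → _ →L[ℝ] _) := by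
    have hcd : ContinuousAt (fderiv ℝ ρ) x := (hρ.fderiv_right (m := 0) (by norm_num)).continuousAt
    have hcp : ContinuousAt (fun y => (fderiv ℝ ρ y).prod A) x := by
      have hc : Continuous fun L : EuclideanSpace ℝ (Fin (k + 1)) →L[ℝ] ℝ => L.prod A :=
        continuous_prod_right A
      exact hc.continuousAt.comp hcd
    have hr := ContinuousLinearEquiv.nhds e
    rw [he] at hr
    filter_upwards [h.open_source.mem_nhds hxs, hρ.eventually (by norm_num),
      hcd.eventually_ne hρ0, eventually_eventually_nhds.2 hX, hcp.eventually_mem hr]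
      with y h1 h2 h3 h4 h5
    exact ⟨h1, h2, h3, h4, h5⟩
  obtain ⟨O, hO, hOo, hxO⟩ := eventually_nhds_iff.1 hgood
  let φ : EuclideanSpace ℝ (Fin k) → EuclideanSpace ℝ (Fin (k + 1)) := fun u => h.symm (0, u)
  have hmk : Tendsto (fun u : EuclideanSpace ℝ (Fin k) => ((0 : ℝ), u)) (𝓝 (A x)) (𝓝 (h x)) := by
    rw [hcoe, hΦx0]
    exact (Continuous.prodMk_right (0 : ℝ)).tendsto (A x)
  have hU : ∀ᶠ u in 𝓝 (A x), ((0 : ℝ), u) ∈ h.target ∧ φ u ∈ O := by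
    refine (hmk.eventually_mem (h.open_target.mem_nhds (h.map_source hxs))).and
      (((h.tendsto_symm hxs).comp hmk).eventually_mem (hOo.mem_nhds hxO))
  obtain ⟨r, hr, hUr⟩ := Metric.eventually_nhds_iff_ball.1 hU
  have hΦφ : ∀ u ∈ Metric.ball (A x) r, ρ (φ u) = 0 := fun u hu =>
    congrArg Prod.fst (h.right_inv (hUr u hu).1)
  have hfr : MapsTo φ (Metric.ball (A x) r) (frontier X) := fun u hu =>
    mem_frontier_of_eq_zero (hO _ (hUr u hu).2).2.2.1 (hO _ (hUr u hu).2).2.2.2.1 (hΦφ u hu)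
  refine ⟨k, rfl, A, φ, Metric.ball (A x) r, O ∩ A ⁻¹' Metric.ball (A x) r, Metric.isOpen_ball,
    convex_ball _ _, ⟨A x, Metric.mem_ball_self hr⟩,
    hOo.inter (Metric.isOpen_ball.preimage A.continuous), ⟨hxO, Metric.mem_ball_self hr⟩, ?_, hfr,
    ?_, ?_⟩
  · intro u hu
    obtain ⟨ht, hu'⟩ := hUr u hu
    obtain ⟨-, hc, -, -, e₁, he₁⟩ := hO _ hu'
    have h1 : ContDiffAt ℝ 1 h.symm (0, u) :=
      h.contDiffAt_symm ht (f₀' := e₁) (he₁ ▸ hΦd _ hc) (hΦc _ hc)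
    exact (h1.comp u (contDiff_prodMk_right (0 : ℝ)).contDiffAt).contDiffWithinAt
  · intro u hu
    obtain ⟨ht, hu'⟩ := hUr u hu
    obtain ⟨-, hc, hne, hXu, e₁, he₁⟩ := hO _ hu'
    have h1 : HasFDerivAt h.symm (e₁.symm : _ →L[ℝ] _) (0, u) :=
      h.hasFDerivAt_symm ht (he₁ ▸ hΦd _ hc)
    -- The normal is proportional to the gradient of `ρ`, so `w ⊥ n` gives `e₁ w = (0, A w)`: the
    -- chart's derivative sends `A w` to `w`.
    refine ⟨_, h1.comp u (hasFDerivAt_prodMk_right (0 : ℝ) u), fun w hw => ⟨A w, ?_⟩⟩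
    obtain ⟨hn, hn1⟩ := outwardNormal_spec hXconvex hXint (hfr hu)
    obtain ⟨b, -, hnb⟩ := exists_inner_eq_mul_fderiv (hc.differentiableAt (by norm_num)) hne hXu
      (hΦφ u hu) hn
    have hb0 : b ≠ 0 := by
      rintro rfl
      have h1 := hnb (outwardNormal X (φ u))
      rw [real_inner_self_eq_norm_sq, hn1] at h1
      norm_num at h1
    have hw0 : fderiv ℝ ρ (φ u) w = 0 := by
      have h2 := hnb w
      rw [real_inner_comm, hw] at h2
      exact (mul_eq_zero.1 h2.symm).resolve_left hb0
    have h3 : e₁ w = (0, A w) := by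
      have : (e₁ : EuclideanSpace ℝ (Fin (k + 1)) →L[ℝ] ℝ × EuclideanSpace ℝ (Fin k)) w =
        (fderiv ℝ ρ (φ u)).prod A w := by rw [he₁]
      simpa [hw0] using this
    simp [← h3]
  · rintro y ⟨⟨hyO, hyA⟩, hyX⟩
    obtain ⟨hys, hc, -, hXy, -⟩ := hO _ hyO
    have h1 : h y = (0, A y) := by
      rw [hcoe]
      simp [Φ, eq_zero_of_mem_frontier hXclosed hc.continuousAt hXy hyX]
    refine ⟨hyA, ?_⟩
    simp only [φ]
    rw [← h1, h.left_inv hys]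

end Boundary

end SubmersionProbe

/-! ### Almost every perturbation has discrete root sets -/

namespace SubmersionProbe

theorem extendZero_apply {d : ℕ} {X : Set (EuclideanSpace ℝ (Fin d))}
    (f : X → EuclideanSpace ℝ (Fin d)) (x : X) : extendZero f x = f x :=
  Subtype.val_injective.extend_apply _ _ _

theorem isDiscrete_of_eventually_notMem {Y : Type*} [TopologicalSpace Y] {D R : Set Y}
    (hRD : R ⊆ D) (h : ∀ x ∈ R, ∀ᶠ y in 𝓝[D \ {x}] x, y ∉ R) : IsDiscrete R := by
  refine .of_nhdsWithin fun x hx => ?_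
  rw [le_pure_iff]
  have h1 := h x hx
  rw [eventually_nhdsWithin_iff] at h1
  filter_upwards [nhdsWithin_le_nhds h1, self_mem_nhdsWithin] with y hy hyR
  by_contra hne
  exact hy ⟨hRD hyR, hne⟩ hyR

section Perturbation

variable {d : ℕ} {X : Set (EuclideanSpace ℝ (Fin d))} {𝒬 : Type*} [AddCommGroup 𝒬] [Module ℝ 𝒬]
  [FunLike 𝒬 X (EuclideanSpace ℝ (Fin d))]

theorem ae_isDiscrete_roots (hXconvex : Convex ℝ X) (hXint : (interior X).Nonempty)
    (P : Submodule ℝ 𝒬) [FiniteDimensional ℝ P] (Q : 𝒬) (hsub : EvalIsC1Submersion P Q) :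
    ∀ᵐ c ∂(volume : Measure (Fin (Module.finrank ℝ P) → ℝ)),
      IsDiscrete (roots (⇑(Q + (coords P c : 𝒬)))) := by
  have h := ae_zeros_isolated volume rfl hXconvex hXint hsub.1 fun z hz =>
    (hsub.2 z hz).imp fun L hL => ⟨hL.1, surjOn_univ.1 hL.2⟩
  filter_upwards [h] with c hc
  have hR : IsDiscrete {x ∈ X | evalMap P Q (c, x) = 0} :=
    isDiscrete_of_eventually_notMem (sep_subset _ _) fun x hx =>
      (hc x hx.1 hx.2).mono fun y hy hy' => hy hy'.2
  have hpre : roots (⇑(Q + (coords P c : 𝒬))) =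
      Subtype.val ⁻¹' {x ∈ X | evalMap P Q (c, x) = 0} := by
    ext x
    simp [roots, evalMap, extendZero_apply]
  rw [hpre]
  exact hR.preimage continuous_subtype_val.continuousOn Subtype.val_injective

/-- Near a boundary point, almost every perturbation has isolated points at which the field is an
outward normal vector. -/
theorem exists_nhds_ae_normal_isolated (hXclosed : IsClosed X) (hXconvex : Convex ℝ X)
    (hXint : (interior X).Nonempty) (hXbdry : HasC2Boundary X)
    (hC1 : ∀ Q : 𝒬, ContDiffOn ℝ 1 (extendZero (⇑Q)) X)
    (P : Submodule ℝ 𝒬) [FiniteDimensional ℝ P] (Q : 𝒬) (hsub : EvalBdryIsC1Submersion P Q)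
    {x₀ : EuclideanSpace ℝ (Fin d)} (hx₀ : x₀ ∈ frontier X) :
    ∃ N, IsOpen N ∧ x₀ ∈ N ∧ ∀ᵐ c ∂(volume : Measure (Fin (Module.finrank ℝ P) → ℝ)),
      ∀ x ∈ N ∩ frontier X, evalMap P Q (c, x) = ‖evalMap P Q (c, x)‖ • outwardNormal X x →
        ∀ᶠ y in 𝓝[frontier X \ {x}] x,
          evalMap P Q (c, y) ≠ ‖evalMap P Q (c, y)‖ • outwardNormal X y := by
  obtain ⟨k, hk, A, φ, U, N, hUo, hUc, hUne, hNo, hx₀N, hφ, hφX, hφd, hAφ⟩ :=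
    exists_boundary_chart hXclosed hXconvex hXint hXbdry hx₀
  refine ⟨N, hNo, hx₀N, ?_⟩
  let C := Fin (Module.finrank ℝ P) → ℝ
  let E := EuclideanSpace ℝ (Fin k) × ℝ
  set D : Set E := U ×ˢ Ici (0 : ℝ) with hD
  let ψ : C × E → C × EuclideanSpace ℝ (Fin d) × ℝ := fun z => (z.1, φ z.2.1, z.2.2)
  let G : C × E → EuclideanSpace ℝ (Fin d) := fun z => evalMapBdry P Q (ψ z)
  have hmaps : MapsTo ψ (univ ×ˢ D) (univ ×ˢ frontier X ×ˢ Ici 0) := fun z hz =>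
    ⟨mem_univ _, hφX hz.2.1, hz.2.2⟩
  have hψ : ContDiffOn ℝ 1 ψ (univ ×ˢ D) := by
    refine contDiff_fst.contDiffOn.prodMk (ContDiffOn.prodMk ?_ ?_)
    · exact hφ.comp (contDiff_fst.comp contDiff_snd).contDiffOn fun z hz => hz.2.1
    · exact (contDiff_snd.comp contDiff_snd).contDiffOn
  have hG : ContDiffOn ℝ 1 G (univ ×ˢ D) := hsub.1.comp hψ hmaps
  have hDc : Convex ℝ D := hUc.prod (convex_Ici 0)
  have hDint : (interior D).Nonempty := by
    rw [hD, interior_prod_eq, hUo.interior_eq, interior_Ici]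
    exact hUne.prod nonempty_Ioi
  have hdim : Module.finrank ℝ E = Module.finrank ℝ (EuclideanSpace ℝ (Fin d)) := by
    simp [E, hk]
  have hsurj : ∀ z ∈ (univ : Set C) ×ˢ D, ∃ L : C × E →L[ℝ] EuclideanSpace ℝ (Fin d),
      HasFDerivWithinAt G L (univ ×ˢ D) z ∧ Function.Surjective L := by
    rintro ⟨c, u, α⟩ hz
    obtain ⟨L, hL, hLs⟩ := hsub.2 _ (hmaps hz)
    obtain ⟨M, hM, hMs⟩ := hφd u hz.2.1
    have hψd : HasFDerivAt ψ ((ContinuousLinearMap.id ℝ C).prodMap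
        (M.prodMap (ContinuousLinearMap.id ℝ ℝ))) (c, u, α) :=
      (hasFDerivAt_id c).prodMap (c, u, α) (hM.prodMap (u, α) (hasFDerivAt_id α))
    refine ⟨_, hL.comp _ hψd.hasFDerivWithinAt hmaps, fun w => ?_⟩
    obtain ⟨⟨a, b, t⟩, hab, rfl⟩ := hLs (mem_univ w)
    obtain ⟨v, rfl⟩ := hMs b hab.2.1
    exact ⟨(a, v, t), rfl⟩
  filter_upwards [ae_zeros_isolated volume hdim hDc hDint hG hsurj] with c hc x hx hroot
  obtain ⟨hAx, hφAx⟩ := hAφ x hx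
  let F : EuclideanSpace ℝ (Fin d) → EuclideanSpace ℝ (Fin d) := fun y => evalMap P Q (c, y)
  have hGF : ∀ y ∈ N ∩ frontier X, G (c, A y, ‖F y‖) = F y - ‖F y‖ • outwardNormal X y := by
    intro y hy
    simp only [G, ψ, (hAφ y hy).2]
    rfl
  have hFc : ContinuousOn F X := (hC1 (Q + (coords P c : 𝒬))).continuousOn
  -- As `n` is a unit vector, `α` can only be `‖F y‖`. This lift is continuous along `∂X`, and
  -- injective near `x` because `A` is, so isolation of zeros of `G (c, ·)` pulls back to `∂X`.
  let τ : EuclideanSpace ℝ (Fin d) → E := fun y => (A y, ‖F y‖)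
  have hN : ∀ᶠ y in 𝓝[frontier X \ {x}] x, y ∈ N :=
    mem_nhdsWithin_of_mem_nhds (hNo.mem_nhds hx.1)
  have hτ : Tendsto τ (𝓝[frontier X \ {x}] x) (𝓝[D \ {τ x}] τ x) := by
    refine tendsto_nhdsWithin_iff.2 ⟨?_, ?_⟩
    · have hFx : Tendsto F (𝓝[frontier X \ {x}] x) (𝓝 (F x)) :=
        (hFc x (hXclosed.frontier_subset hx.2)).mono_left
          (nhdsWithin_mono _ (sdiff_subset.trans hXclosed.frontier_subset))
      exact ((A.continuous.tendsto x).mono_left nhdsWithin_le_nhds).prodMk_nhds hFx.norm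
    · filter_upwards [hN, self_mem_nhdsWithin] with y hyN hy
      obtain ⟨hAy, hφAy⟩ := hAφ y ⟨hyN, hy.1⟩
      refine ⟨⟨hAy, norm_nonneg _⟩, fun h => hy.2 ?_⟩
      have h1 : A y = A x := congrArg Prod.fst h
      rw [mem_singleton_iff, ← hφAy, h1, hφAx]
  have hzero : G (c, τ x) = 0 := (hGF x hx).trans (sub_eq_zero.2 hroot)
  filter_upwards [hτ.eventually (hc (τ x) ⟨hAx, norm_nonneg _⟩ hzero), hN, self_mem_nhdsWithin]
    with y hy hyN hyX h
  exact hy ((hGF y ⟨hyN, hyX.1⟩).trans (sub_eq_zero.2 h))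

/-- Countably many local neighbourhoods cover `∂X`. Only the inclusion of the roots in the set where
the field is an outward normal is needed, since subsets of discrete sets are discrete. -/
theorem ae_isDiscrete_roots_projectedField (hXclosed : IsClosed X) (hXconvex : Convex ℝ X)
    (hXint : (interior X).Nonempty) (hXbdry : HasC2Boundary X)
    (hC1 : ∀ Q : 𝒬, ContDiffOn ℝ 1 (extendZero (⇑Q)) X)
    (P : Submodule ℝ 𝒬) [FiniteDimensional ℝ P] (Q : 𝒬) (hsub : EvalBdryIsC1Submersion P Q) :
    ∀ᵐ c ∂(volume : Measure (Fin (Module.finrank ℝ P) → ℝ)),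
      IsDiscrete (roots fun x : bdry X => projectedField (⇑(Q + (coords P c : 𝒬))) (x : X)) := by
  have hloc := fun x (hx : x ∈ frontier X) =>
    exists_nhds_ae_normal_isolated hXclosed hXconvex hXint hXbdry hC1 P Q hsub hx
  choose! N hNo hxN hN using hloc
  obtain ⟨t, htX, htc, hcover⟩ := TopologicalSpace.countable_cover_nhdsWithin fun x hx =>
    mem_nhdsWithin_of_mem_nhds ((hNo x hx).mem_nhds (hxN x hx))
  filter_upwards [(ae_ball_iff htc).2 fun x hx => hN x (htX hx)] with c hc
  have hR : IsDiscrete {x ∈ frontier X |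
      evalMap P Q (c, x) = ‖evalMap P Q (c, x)‖ • outwardNormal X x} := by
    refine isDiscrete_of_eventually_notMem (sep_subset _ _) fun x hx => ?_
    obtain ⟨x₁, hx₁, hxx₁⟩ := mem_iUnion₂.1 (hcover hx.1)
    exact (hc x₁ hx₁ x ⟨hxx₁, hx.1⟩ hx.2).mono fun y hy hy' => hy hy'.2
  let i : bdry X → EuclideanSpace ℝ (Fin d) := fun x => ((x : X) : EuclideanSpace ℝ (Fin d))
  have hi : Continuous i := continuous_subtype_val.comp continuous_subtype_val
  refine (hR.preimage hi.continuousOn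
    (Subtype.val_injective.comp Subtype.val_injective)).mono fun x hx => ⟨x.2, ?_⟩
  have h1 := eq_norm_smul_outwardNormal hXclosed hXconvex hXint hXbdry x.2
    (mem_normalCone_of_metricProj_eq_zero (x : X).2 hx)
  have h2 : evalMap P Q (c, i x) = (Q + (coords P c : 𝒬)) (x : X) := extendZero_apply _ _
  rw [h2]
  exact h1

end Perturbation

end SubmersionProbe

theorem mainTheorem3 {d : ℕ} {X : Set (EuclideanSpace ℝ (Fin d))}
    (hXclosed : IsClosed X) (hXconvex : Convex ℝ X) (hXint : (interior X).Nonempty)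
    (hXbdry : SubmersionProbe.HasC2Boundary X)
    {𝒬 : Type*} [AddCommGroup 𝒬] [Module ℝ 𝒬] [MetricSpace 𝒬] [CompleteSpace 𝒬]
    [IsTopologicalAddGroup 𝒬] [ContinuousSMul ℝ 𝒬]
    [FunLike 𝒬 X (EuclideanSpace ℝ (Fin d))]
    (hC1 : ∀ Q : 𝒬, ContDiffOn ℝ 1 (SubmersionProbe.extendZero (⇑Q)) X)
    (P : Submodule ℝ 𝒬) [FiniteDimensional ℝ P]
    (hsub : ∀ Q : 𝒬, SubmersionProbe.EvalIsC1Submersion P Q)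
    (hsubBdry : ∀ Q : 𝒬, SubmersionProbe.EvalBdryIsC1Submersion P Q) :
    SubmersionProbe.IsPrevalent {Q : 𝒬 |
      IsDiscrete (SubmersionProbe.roots (⇑Q)) ∧
      IsDiscrete (SubmersionProbe.roots fun x : SubmersionProbe.bdry X =>
        SubmersionProbe.projectedField (⇑Q) (x : X))} := by
  refine ⟨P, inferInstance, fun Q => ?_⟩
  filter_upwards [SubmersionProbe.ae_isDiscrete_roots hXconvex hXint P Q (hsub Q),
    SubmersionProbe.ae_isDiscrete_roots_projectedField hXclosed hXconvex hXint hXbdry hC1 P Q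
      (hsubBdry Q)] with c h₁ h₂
  exact ⟨h₁, h₂⟩
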